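/- Let $X$ be a curve of genus $g$ over a finite field $\mathbb F_q$, that is, a non-singular projective irreducible curve over $\overline{\mathbb F}_q$ which is defined over $\mathbb F_q$. Let $K\ge 1$ be an integer with $K>g-1$, let $D$ be a divisor on $X$ defined over $\mathbb F_q$ of degree $K+g-1$, and let $\mathbf P=\{P_1,\dots,P_L\}\subseteq X(\mathbb F_q)$ be a set of $L$ distinct rational points, none of which lies in the support of $D$. Let $\mathcal L(D)=\{f\in\mathbb F_q(X)\setminus\{0\} : (f)\ge -D\}\cup\{0\}$, an $\mathbb F_q$-vector space (of dimension $K$). Let $B_0$ be any ordered basis of $\mathcal L(D)$ over $\mathbb F_q$ and, for $1\le i\le L$, let $B_i=(B_{i1},\dots,B_{iK})$ be an increasing zero basis of $\mathcal L(D)$ at $P_i$ over $\mathbb F_q$, i.e. an ordered basis with $v_{P_i}(B_{i,j+1})>v_{P_i}(B_{ij})$ for $1\le j<K$, normalized so that $B_{i1}(P_i)=1$. Let $M_i\in\mathbb F_q^{K\times K}$ be the change-of-basis matrix defined by $M_iB_i=B_0$, where the bases are written as column vectors. Let $G$ be the $K\times L$ matrix whose $i$-th column is the first column of $M_i$. Then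 $G$ is a generator matrix of the Goppa code $$\mathbf C(X,\mathbf P,D)=\{(f(P_1),\dots,f(P_L)) : f\in\mathcal L(D)\}\subseteq\mathbb F_q^L,$$ in the following sense: the rows of $G$ span $\mathbf C(X,\mathbf P,D)$ over $\mathbb F_q$, and if $L\ge K+g$ (that is, $L>\deg D$), then the rows of $G$ are linearly independent, so that they form a basis of $\mathbf C(X,\mathbf P,D)$. -/

import Mathlib

open AlgebraicGeometry CategoryTheory Module
open scoped KaehlerDifferential

universe u

/-- A curve over a field `k`: a proper, geometrically integral scheme over `k`, smooth of relative
dimension one.  For `k = 𝔽_q` this is the same as a non-singular projective irreducible curve over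
the algebraic closure of `𝔽_q` that is defined over `𝔽_q` (for smooth curves, proper and
projective agree). -/
structure Curve (k : Type u) [Field k] where
  /-- the underlying scheme -/
  X : Scheme.{u}
  /-- the structure morphism -/
  str : X ⟶ Spec (.of k)
  proper : IsProper str
  geomIntegral : GeometricallyIntegral str
  smooth : SmoothOfRelativeDimension 1 str

namespace Curve

variable {k : Type u} [Field k] (C : Curve k)

instance : IsProper C.str := C.proper
instance : GeometricallyIntegral C.str := C.geomIntegral
instance : SmoothOfRelativeDimension 1 C.str := C.smooth
instance : AlgebraicGeometry.IsIntegral C.X := GeometricallyIntegral.isIntegral_of_subsingleton C.str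
instance : IsLocallyNoetherian C.X := LocallyOfFiniteType.isLocallyNoetherian C.str

/-- The function field `k(X)`, the field of rational functions defined over `k`. -/
noncomputable abbrev FunctionField : Type u := C.X.functionField

/-- The local ring `𝒪_{X,x}`. -/
noncomputable abbrev LocalRing (x : C.X) : Type u := C.X.presheaf.stalk x

/-- The ring map `k → Γ(X, 𝒪_X) → 𝒪_{X,x}` (for `x` the generic point: `k → k(X)`). -/
noncomputable instance (x : C.X) : Algebra k (C.X.presheaf.stalk x) :=
  ((Scheme.ΓSpecIso (.of k)).inv ≫ C.str.appTop ≫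
    C.X.presheaf.germ ⊤ x (TopologicalSpace.Opens.mem_top x)).hom.toAlgebra

instance (x : C.X) : IsScalarTower k (C.X.presheaf.stalk x) C.X.functionField := by
  apply IsScalarTower.of_algebraMap_eq'
  simp only [RingHom.algebraMap_toAlgebra]
  rw [← CommRingCat.hom_comp]
  congr 1
  simp only [Category.assoc]
  congr 2
  exact (C.X.presheaf.germ_stalkSpecializes (TopologicalSpace.Opens.mem_top x) _).symm

/-- The maximal ideal of every local ring of a curve is principal, and the local ring at a closed
point is not a field. -/
theorem localRing_aux (x : C.X) :
    (IsLocalRing.maximalIdeal (C.X.presheaf.stalk x)).IsPrincipal ∧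
      (IsClosed ({x} : Set C.X) → ¬ IsField (C.X.presheaf.stalk x)) := by
  obtain ⟨U, hU, V, hV, hxV, e, h⟩ :=
    SmoothOfRelativeDimension.exists_isStandardSmoothOfRelativeDimension (n := 1) (f := C.str) x
  have hU' : U = ⊤ := by
    ext y
    simpa [Subsingleton.elim y (C.str x)] using e hxV
  subst hU'
  have hF : IsField Γ(Spec (.of k), ⊤) :=
    (Scheme.ΓSpecIso (.of k)).commRingCatIsoToRingEquiv.toMulEquiv.isField (Field.toIsField k)
  let := hF.toField
  obtain ⟨g, -, hg⟩ := h.exists_etale_mvPolynomial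
  let E := MvPolynomial.uniqueAlgEquiv Γ(Spec (.of k), ⊤) (Fin 1)
  have : IsPrincipalIdealRing (MvPolynomial (Fin 1) Γ(Spec (.of k), ⊤)) :=
    IsPrincipalIdealRing.of_surjective E.symm.toRingHom E.symm.surjective
  have hE : ¬ IsField (MvPolynomial (Fin 1) Γ(Spec (.of k), ⊤)) := fun h ↦
    Polynomial.not_isField _ (E.symm.toMulEquiv.isField h)
  algebraize [g]
  let q := (hV.primeIdealOf ⟨x, hxV⟩).asIdeal
  let p := q.under (MvPolynomial (Fin 1) Γ(Spec (.of k), ⊤))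
  let := Localization.AtPrime.algebraOfLiesOver p q
  have h1 := ((Algebra.isUnramifiedAt_iff_map_eq
    (MvPolynomial (Fin 1) Γ(Spec (.of k), ⊤)) p q).mp inferInstance).2
  have h2 : (IsLocalRing.maximalIdeal (Localization.AtPrime q)).IsPrincipal := by
    rw [← h1]; infer_instance
  let := C.X.presheaf.algebra_section_stalk (⟨x, hxV⟩ : V)
  have : IsLocalization.AtPrime (C.X.presheaf.stalk x) q := hV.isLocalization_stalk ⟨x, hxV⟩
  let ε : Localization.AtPrime q ≃ₐ[Γ(C.X, V)] C.X.presheaf.stalk x :=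
    IsLocalization.algEquiv q.primeCompl _ _
  refine ⟨?_, fun hx hf ↦ ?_⟩
  · rw [← IsLocalRing.map_ringEquiv_maximalIdeal ε.toRingEquiv]
    exact Submodule.IsPrincipal.map_ringHom ε.toRingEquiv.toRingHom h2
  · have : Nonempty V := ⟨⟨x, hxV⟩⟩
    have hq : q.IsMaximal := by
      rw [← PrimeSpectrum.isClosed_singleton_iff_isMaximal]
      let z : Spec Γ(C.X, V) := hV.primeIdealOf ⟨x, hxV⟩
      have h4 : hV.fromSpec ⁻¹' {x} = ({z} : Set (Spec Γ(C.X, V))) := by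
        refine Set.ext fun y ↦ ?_
        rw [Set.mem_preimage, Set.mem_singleton_iff, Set.mem_singleton_iff,
          ← hV.fromSpec.isOpenEmbedding.injective.eq_iff, hV.fromSpec_primeIdealOf]
      have h5 : IsClosed ({z} : Set (Spec Γ(C.X, V))) := h4 ▸ hx.preimage hV.fromSpec.continuous
      exact h5
    have hqb : q = ⊥ := by
      have h0 : IsLocalRing.maximalIdeal (C.X.presheaf.stalk x) = ⊥ :=
        IsLocalRing.isField_iff_maximalIdeal_eq.mp hf
      rw [← IsLocalization.AtPrime.under_maximalIdeal (C.X.presheaf.stalk x) q, h0]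
      rw [Ideal.under_def, ← RingHom.ker_eq_comap_bot, ← RingHom.injective_iff_ker_eq_bot]
      exact germ_injective_of_isIntegral C.X x hxV
    have hinj : Function.Injective
        (algebraMap (MvPolynomial (Fin 1) Γ(Spec (.of k), ⊤)) Γ(C.X, V)) := by
      rw [injective_iff_map_eq_zero]
      intro a ha
      by_contra h0
      have h3 := (IsSMulRegular.of_ne_zero h0 :
        IsSMulRegular (MvPolynomial (Fin 1) Γ(Spec (.of k), ⊤)) a).of_flat (S := Γ(C.X, V))
      exact one_ne_zero (h3 (by simp [ha]) : (1 : Γ(C.X, V)) = 0)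
    let := Ideal.Quotient.field q
    have := finite_of_finite_type_of_isJacobsonRing
      (MvPolynomial (Fin 1) Γ(Spec (.of k), ⊤)) (Γ(C.X, V) ⧸ q)
    refine hE (isField_of_isIntegral_of_isField (S := Γ(C.X, V) ⧸ q) ?_ (Field.toIsField _))
    have hinj' : Function.Injective (Ideal.Quotient.mk q) := by
      rw [RingHom.injective_iff_ker_eq_bot, Ideal.mk_ker, hqb]
    exact hinj'.comp hinj

theorem coheight_eq_one {x : C.X} (hx : IsClosed ({x} : Set C.X)) : Order.coheight x = 1 := by
  have : IsPrincipalIdealRing (C.X.presheaf.stalk x) :=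
    ((tfae_of_isNoetherianRing_of_isLocalRing_of_isDomain (R := C.X.presheaf.stalk x)).out 4 0).mp
      (C.localRing_aux x).1
  have := IsPrincipalIdealRing.ringKrullDim_eq_one _ ((C.localRing_aux x).2 hx)
  rw [ringKrullDim_stalk_eq_coheight] at this
  exact_mod_cast this

theorem isDiscreteValuationRing {x : C.X} (hx : IsClosed ({x} : Set C.X)) :
    IsDiscreteValuationRing (C.X.presheaf.stalk x) :=
  ((IsDiscreteValuationRing.TFAE _ ((C.localRing_aux x).2 hx)).out 4 0).mp (C.localRing_aux x).1

/-- Closed points of `X`.  For `k = 𝔽_q` they correspond to the Galois orbits of points of the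
curve over the algebraic closure. -/
abbrev ClosedPoint : Type u := {x : C.X // IsClosed ({x} : Set C.X)}

/-- Divisors on `X` defined over `k`: finite formal integer combinations of closed points (for
`k = 𝔽_q` these are the Galois-invariant combinations of points over the algebraic closure). -/
abbrev Divisor : Type u := C.ClosedPoint →₀ ℤ

/-- The degree of a divisor; a closed point counts with the degree of its residue field over `k`,
which is the number of points in its Galois orbit. -/
noncomputable def degree (D : C.Divisor) : ℤ :=
  D.sum fun x n ↦ n * (C.str.residueDegree x.1 : ℤ)

/-- The valuation `v_x(f)`: the order of vanishing of `f` at the closed point `x`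
(meaningful for `f ≠ 0`). -/
noncomputable def ord (x : C.ClosedPoint) (f : C.FunctionField) : ℤ := Scheme.ord f x.1

theorem ord_add (x : C.ClosedPoint) {f g : C.FunctionField} (h : f + g ≠ 0) :
    min (C.ord x f) (C.ord x g) ≤ C.ord x (f + g) :=
  have := C.isDiscreteValuationRing x.2
  Scheme.ord_add h

theorem ord_algebraMap (x : C.ClosedPoint) {c : k} (hc : c ≠ 0) :
    C.ord x (algebraMap k C.FunctionField c) = 0 := by
  have hu : IsUnit ((C.str.appTop).hom ((Scheme.ΓSpecIso (.of k)).inv.hom c)) :=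
    ((IsUnit.mk0 c hc).map _).map _
  have : Nonempty (⊤ : C.X.Opens) := ⟨⟨x.1, TopologicalSpace.Opens.mem_top _⟩⟩
  exact Scheme.ord_of_isUnit (U := ⊤) hu (TopologicalSpace.Opens.mem_top x.1)

/-- The Riemann-Roch space `ℒ(D)` over `k`: zero and the nonzero `f ∈ k(X)` with `(f) ≥ -D`. -/
noncomputable def riemannRochSpace (D : C.Divisor) : Submodule k C.FunctionField where
  carrier := {f | f ≠ 0 → ∀ x : C.ClosedPoint, -D x ≤ C.ord x f}
  zero_mem' h := absurd rfl h
  add_mem' {f g} hf hg h x := by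
    by_cases hf0 : f = 0
    · subst hf0; simp only [zero_add] at h ⊢; exact hg h x
    by_cases hg0 : g = 0
    · subst hg0; simp only [add_zero] at h ⊢; exact hf h x
    exact (le_min (hf hf0 x) (hg hg0 x)).trans (C.ord_add x h)
  smul_mem' c f hf h x := by
    have hc : c ≠ 0 := by rintro rfl; simp at h
    have hf0 : f ≠ 0 := by rintro rfl; simp at h
    have hc' : algebraMap k C.FunctionField c ≠ 0 := by simpa using hc
    rw [Algebra.smul_def, ord, Scheme.ord_mul hc' hf0]
    have := C.ord_algebraMap x hc
    rw [ord] at this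
    rw [this, zero_add]
    exact hf hf0 x

/-- The space `H⁰(X, Ω)` of regular differentials: those `ω ∈ Ω_{k(X)/k}` which at every closed
point `x` come from `Ω_{𝒪_{X,x}/k}`, that is, `ω = h dt` with `h ∈ 𝒪_{X,x}` and `t` a uniformizer. -/
noncomputable def regularDifferentials : Submodule k Ω[C.FunctionField⁄k] :=
  ⨅ x : C.ClosedPoint, (LinearMap.range
    (KaehlerDifferential.map k k (C.LocalRing x.1) C.FunctionField)).restrictScalars k

/-- The genus of `X`: the dimension of the space of regular differentials, that is, `ℓ(κ)` for a
canonical divisor `κ`. -/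
noncomputable def genus : ℕ := finrank k C.regularDifferentials

/-- The set `X(k)` of points defined over `k`. -/
abbrev RationalPoint : Type u := {P : Spec (.of k) ⟶ C.X // P ≫ C.str = 𝟙 _}

variable {C}

/-- The closed point of `X` underlying a point defined over `k`. -/
noncomputable def RationalPoint.toClosedPoint (P : C.RationalPoint) : C.ClosedPoint :=
  ⟨P.1 (IsLocalRing.closedPoint k), by
    have := isClosedImmersion_of_comp_eq_id _ _ P.2
    have := P.1.isClosedEmbedding.isClosed_range
    rwa [Set.range_eq_singleton] at this
    exact fun x ↦ congr(P.1 $(Subsingleton.elim _ _))⟩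

open Classical in
/-- The value `f(P) ∈ k` of a function `f` regular at `P`: the image of `f ∈ 𝒪_{X,P}` under
`𝒪_{X,P} → k`.  (The default value `0` is used if `f` is not regular at `P`.) -/
noncomputable def RationalPoint.eval (P : C.RationalPoint) (f : C.FunctionField) : k :=
  if h : ∃ s : C.X.presheaf.stalk (P.1 (IsLocalRing.closedPoint k)),
      algebraMap (C.X.presheaf.stalk (P.1 (IsLocalRing.closedPoint k))) C.X.functionField s = f
  then (Scheme.stalkClosedPointTo P.1).hom h.choose else 0

/-- An ordered basis of `ℒ(D)` is an increasing zero basis at `P` if the order of vanishing at `P`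
strictly increases along it. -/
def IsIncreasingZeroBasis {D : C.Divisor} {n : ℕ} (P : C.RationalPoint)
    (B : Basis (Fin n) k (C.riemannRochSpace D)) : Prop :=
  StrictMono fun j ↦ C.ord P.toClosedPoint (B j : C.FunctionField)

/-- The change-of-basis matrix `M` from `B₀` to `B`, characterised by `M B = B₀` with the bases
written as column vectors: row `a` holds the coordinates of `B₀ a` in the basis `B`. -/
noncomputable def changeOfBasis {D : C.Divisor} {n : ℕ}
    (B₀ B : Basis (Fin n) k (C.riemannRochSpace D)) : Matrix (Fin n) (Fin n) k :=
  Matrix.of fun a b ↦ B.repr (B₀ a) b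

theorem changeOfBasis_mul {D : C.Divisor} {n : ℕ}
    (B₀ B : Basis (Fin n) k (C.riemannRochSpace D)) (a : Fin n) :
    ∑ b, changeOfBasis B₀ B a b • B b = B₀ a :=
  B.sum_repr (B₀ a)

/-- The Goppa code `{(f(P₁), …, f(P_L)) | f ∈ ℒ(D)}`. -/
def goppaCode {L : ℕ} (P : Fin L → C.RationalPoint) (D : C.Divisor) : Set (Fin L → k) :=
  {w | ∃ f ∈ C.riemannRochSpace D, w = fun i ↦ (P i).eval f}

/-- The matrix whose `i`-th column is the first column of the `i`-th matrix. -/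
def firstColumns {K L : ℕ} (hK : 0 < K) (M : Fin L → Matrix (Fin K) (Fin K) k) :
    Matrix (Fin K) (Fin L) k :=
  Matrix.of fun a i ↦ M i a ⟨0, hK⟩

end Curve

/-!
Let `f ∈ ℒ(D)`.  The functions of an increasing zero basis at `Pᵢ` are regular at `Pᵢ`, as `Pᵢ` is
not in the support of `D`, and all but the first vanish there, while the first takes the value `1`.
So the first coordinate of `f` in the basis `B i` is the value `f(Pᵢ)`
(`Curve.repr_zero_eq_eval`), and the rows of `G` are the images of the basis `B₀` under the
evaluation map `ℒ(D) → kᴸ` (`Curve.evalMap`).  They span the image of this map, the Goppa code, and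
they are linearly independent once the map is injective.

A function in the kernel of the evaluation map lies in `ℒ(D - P₁ - ⋯ - P_L)`.  If `deg D < L`, it
vanishes because the Riemann-Roch space of a divisor of negative degree is zero
(`Curve.degree_nonneg`).  This amounts to the inequality `deg Z ≤ deg P` for a nonzero function `f`
vanishing along an effective divisor `Z` with poles bounded by an effective divisor `P`.  It follows
from a dimension count (`OrderFamily.IsGlobal.sum_deg_le`).  Weak approximation provides a space `U`
of functions regular along `Z`, of dimension `deg Z`, in which only zero vanishes along `Z`
(`exists_disjoint_orderGE_count`).  The sum of `f ^ i * U` over `i < l` is then direct, so it has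
dimension `l * deg Z`; and it is contained in `ℒ(l * P + S)` for a fixed `S`, which has dimension at
most `l * deg P + O(1)` (`finrank_space_count_le`).  Letting `l` grow gives the inequality.

The count uses the following properties of the orders of vanishing at the closed points, collected
in `OrderFamily.IsGlobal`.  Leading coefficients at `x` form the residue field, whose dimension is
the degree of `x`.  A rational function has finitely many poles.  Weak approximation rests on the
fact that no local ring at a closed point contains another one, which is where separatedness enters
(`Curve.exists_ord_neg`).  Functions without poles are global sections, and these form a
finite-dimensional space because the curve is proper (`Curve.finite_constants`).
-/

/-! ### Families of orders on a field -/

/-- A family, indexed by `ι`, of discrete orders of vanishing on a field `F` that are trivial on the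
constant field `k`.  The value `ord x 0` carries no meaning. -/
structure OrderFamily (k F ι : Type*) [Field k] [Field F] [Algebra k F] where
  /-- the order of vanishing at the place `x` -/
  ord : ι → F → ℤ
  ord_mul : ∀ x {f g : F}, f ≠ 0 → g ≠ 0 → ord x (f * g) = ord x f + ord x g
  ord_add : ∀ x {f g : F}, f + g ≠ 0 → min (ord x f) (ord x g) ≤ ord x (f + g)
  ord_algebraMap : ∀ x {c : k}, c ≠ 0 → ord x (algebraMap k F c) = 0

namespace OrderFamily

variable {k F ι : Type*} [Field k] [Field F] [Algebra k F] (v : OrderFamily k F ι)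

/-- The functions vanishing at the place `x` to order at least `n`, together with zero. -/
def orderGE (x : ι) (n : ℤ) : Submodule k F where
  carrier := {f | f ≠ 0 → n ≤ v.ord x f}
  zero_mem' h := absurd rfl h
  add_mem' {f g} hf hg h := by
    by_cases hf0 : f = 0
    · subst hf0; simp only [zero_add] at h ⊢; exact hg h
    by_cases hg0 : g = 0
    · subst hg0; simp only [add_zero] at h ⊢; exact hf h
    exact (le_min (hf hf0) (hg hg0)).trans (v.ord_add x h)
  smul_mem' c f hf h := by
    have hc : c ≠ 0 := by rintro rfl; simp at h
    have hf0 : f ≠ 0 := by rintro rfl; simp at h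
    rw [Algebra.smul_def, v.ord_mul x (by simpa using hc) hf0, v.ord_algebraMap x hc, zero_add]
    exact hf hf0

/-- The functions whose divisor is at least `-D`, together with zero. -/
def space (D : ι → ℤ) : Submodule k F := ⨅ x, v.orderGE x (-D x)

/-- The axioms that make a family of orders behave like the set of all places of a function field
of one variable, `deg x` being the degree of the residue field of the place `x`. -/
structure IsGlobal (deg : ι → ℕ) : Prop where
  exists_leadingCoeff : ∀ x n, ∃ φ : v.orderGE x n →ₗ[k] (Fin (deg x) → k),
    Function.Surjective φ ∧ ∀ f, φ f = 0 ↔ (f : F) ∈ v.orderGE x (n + 1)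
  finite_poles : ∀ f : F, {x | v.ord x f < 0}.Finite
  exists_ord_neg : ∀ {x y}, x ≠ y → ∃ f : F, f ≠ 0 ∧ 0 ≤ v.ord x f ∧ v.ord y f < 0
  finite_constants : FiniteDimensional k (v.space 0)

variable {v}

theorem mem_space {D : ι → ℤ} {f : F} : f ∈ v.space D ↔ ∀ x, f ∈ v.orderGE x (-D x) :=
  Submodule.mem_iInf _

theorem orderGE_anti (x : ι) {m n : ℤ} (h : m ≤ n) : v.orderGE x n ≤ v.orderGE x m :=
  fun _ hf h0 ↦ h.trans (hf h0)

theorem mul_mem_orderGE {x : ι} {m n : ℤ} {f g : F} (hf : f ∈ v.orderGE x m)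
    (hg : g ∈ v.orderGE x n) : f * g ∈ v.orderGE x (m + n) := fun h ↦ by
  have hf0 := left_ne_zero_of_mul h
  have hg0 := right_ne_zero_of_mul h
  rw [v.ord_mul x hf0 hg0]
  exact add_le_add (hf hf0) (hg hg0)

theorem ord_one (x : ι) : v.ord x 1 = 0 := by
  simpa using v.ord_algebraMap x (one_ne_zero : (1 : k) ≠ 0)

theorem one_mem_orderGE (x : ι) : (1 : F) ∈ v.orderGE x 0 := fun _ ↦ (ord_one x).ge

theorem ord_inv (x : ι) {f : F} (hf : f ≠ 0) : v.ord x f⁻¹ = -v.ord x f := by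
  have := v.ord_mul x hf (inv_ne_zero hf)
  rw [mul_inv_cancel₀ hf, ord_one] at this
  omega

theorem ord_pow (x : ι) {f : F} (hf : f ≠ 0) (n : ℕ) : v.ord x (f ^ n) = n * v.ord x f := by
  induction n with
  | zero => simp [ord_one]
  | succ n ih => rw [pow_succ, v.ord_mul x (pow_ne_zero n hf) hf, ih]; push_cast; ring

theorem pow_mem_orderGE {x : ι} {m : ℤ} {f : F} (hf : f ∈ v.orderGE x m) (n : ℕ) :
    f ^ n ∈ v.orderGE x (n * m) := fun h ↦ by
  obtain rfl | hn := Nat.eq_zero_or_pos n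
  · simp [ord_one]
  have hf0 : f ≠ 0 := by rintro rfl; simp [hn.ne'] at h
  rw [ord_pow x hf0]
  exact mul_le_mul_of_nonneg_left (hf hf0) (by positivity)

theorem ord_neg (x : ι) (f : F) : v.ord x (-f) = v.ord x f := by
  by_cases hf : f = 0
  · simp [hf]
  have h1 : v.ord x (-1 : F) = 0 := by
    simpa using v.ord_algebraMap x (neg_ne_zero.mpr one_ne_zero : (-1 : k) ≠ 0)
  rw [neg_eq_neg_one_mul, v.ord_mul x (by simp) hf, h1, zero_add]

theorem ord_add_eq_of_lt {x : ι} {f g : F} (hf : f ≠ 0) (h : v.ord x f < v.ord x g) :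
    f + g ≠ 0 ∧ v.ord x (f + g) = v.ord x f := by
  have h0 : f + g ≠ 0 := fun h0 ↦ by
    rw [eq_neg_of_add_eq_zero_left h0, ord_neg] at h
    exact h.false
  refine ⟨h0, le_antisymm ?_ ?_⟩
  · have := v.ord_add x (f := f + g) (g := -g) (by simpa using hf)
    rw [ord_neg, add_neg_cancel_right] at this
    omega
  · have := v.ord_add x h0
    omega

/-! ### Weak approximation -/

namespace IsGlobal

variable {deg : ι → ℕ} (hv : v.IsGlobal deg)
include hv

theorem exists_ord_neg_ord_pos {x y : ι} (hxy : x ≠ y) :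
    ∃ f : F, f ≠ 0 ∧ v.ord x f < 0 ∧ 0 < v.ord y f := by
  obtain ⟨f, hf, hfx, hfy⟩ := hv.exists_ord_neg hxy
  obtain ⟨g, hg, hgy, hgx⟩ := hv.exists_ord_neg hxy.symm
  refine ⟨g * f⁻¹, mul_ne_zero hg (inv_ne_zero hf), ?_, ?_⟩ <;>
    rw [v.ord_mul _ hg (inv_ne_zero hf), ord_inv _ hf] <;> omega

/-- The induction adds a place `z` to `S`.  If the function `a` found so far has a pole at `z`, it
is replaced by `a ^ N / (1 + a ^ N)`, a unit at `x` and at `z` that still vanishes on `S`. -/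
theorem exists_ord_neg_forall_ord_pos {x : ι} {S : Finset ι} (hS : S.Nonempty) (hx : x ∉ S) :
    ∃ f : F, f ≠ 0 ∧ v.ord x f < 0 ∧ ∀ y ∈ S, 0 < v.ord y f := by
  induction hS using Finset.Nonempty.cons_induction with
  | singleton z =>
    obtain ⟨f, hf, hfx, hfz⟩ := hv.exists_ord_neg_ord_pos (x := x) (y := z) (by simpa using hx)
    exact ⟨f, hf, hfx, by simpa using hfz⟩
  | cons z S hz hS ih =>
    rw [Finset.mem_cons, not_or] at hx
    obtain ⟨a, ha, hax, haS⟩ := ih hx.2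
    obtain ⟨b, hb, hbx, hbz⟩ := hv.exists_ord_neg_ord_pos hx.1
    -- the power `a ^ N` compensates the poles of `b` on `S`
    let N : ℕ := ∑ y ∈ S, (v.ord y b).natAbs + 1
    have hN : (0 : ℤ) < N := by positivity
    have hNS : ∀ y ∈ S, 0 < N * v.ord y a + v.ord y b := fun y hy ↦ by
      have h1 : (v.ord y b).natAbs < N :=
        Nat.lt_succ_of_le (Finset.single_le_sum_of_canonicallyOrdered
          (f := fun y ↦ (v.ord y b).natAbs) hy)
      have h2 : (N : ℤ) * 1 ≤ N * v.ord y a :=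
        mul_le_mul_of_nonneg_left (haS y hy) hN.le
      omega
    have haN : a ^ N ≠ 0 := pow_ne_zero N ha
    obtain haz | haz := le_or_gt 0 (v.ord z a)
    · refine ⟨a ^ N * b, mul_ne_zero haN hb, ?_, ?_⟩
      · rw [v.ord_mul x haN hb, ord_pow x ha]
        nlinarith
      · intro y hy
        rw [v.ord_mul y haN hb, ord_pow y ha]
        rcases Finset.mem_cons.mp hy with rfl | hy
        · positivity
        · exact hNS y hy
    · have pole : ∀ y, v.ord y a < 0 →
          a ^ N + 1 ≠ 0 ∧ v.ord y (a ^ N + 1) = v.ord y (a ^ N) := fun y hy ↦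
        ord_add_eq_of_lt haN (by rw [ord_pow y ha, ord_one]; nlinarith)
      have h1 : a ^ N + 1 ≠ 0 := (pole x hax).1
      have hc : ∀ y, v.ord y (a ^ N * (a ^ N + 1)⁻¹ * b) =
          v.ord y (a ^ N) - v.ord y (a ^ N + 1) + v.ord y b := fun y ↦ by
        rw [v.ord_mul y (mul_ne_zero haN (inv_ne_zero h1)) hb,
          v.ord_mul y haN (inv_ne_zero h1), ord_inv y h1]
        ring
      refine ⟨a ^ N * (a ^ N + 1)⁻¹ * b,
        mul_ne_zero (mul_ne_zero haN (inv_ne_zero h1)) hb, ?_, ?_⟩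
      · rw [hc, (pole x hax).2]
        omega
      · intro y hy
        rcases Finset.mem_cons.mp hy with rfl | hy
        · rw [hc, (pole y haz).2]
          omega
        · have h2 : v.ord y (1 + a ^ N) = v.ord y 1 :=
            (ord_add_eq_of_lt one_ne_zero (by
              rw [ord_pow y ha, ord_one]
              exact mul_pos hN (haS y hy))).2
          rw [hc, add_comm (a ^ N), h2, ord_one, ord_pow y ha]
          linarith [hNS y hy]

/-- If `a` has a pole at `x` and zeros at the other places of `S`, then `a / (a + 1)` is close to
`1` at `x` and vanishes at the other places. -/
theorem exists_sub_one_mem_orderGE (x : ι) (S : Finset ι) :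
    ∃ e : F, e - 1 ∈ v.orderGE x 1 ∧ ∀ y ∈ S, y ≠ x → e ∈ v.orderGE y 1 := by
  classical
  obtain hS | hS := (S.erase x).eq_empty_or_nonempty
  · refine ⟨1, by simp, fun y hy hyx ↦ ?_⟩
    have : y ∈ S.erase x := Finset.mem_erase.mpr ⟨hyx, hy⟩
    simp [hS] at this
  obtain ⟨a, ha, hax, haS⟩ := hv.exists_ord_neg_forall_ord_pos hS (Finset.notMem_erase x S)
  have hx := ord_add_eq_of_lt ha (by rwa [ord_one]) (v := v) (x := x)
  have h1 : a + 1 ≠ 0 := hx.1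
  refine ⟨a * (a + 1)⁻¹, ?_, fun y hy hyx _ ↦ ?_⟩
  · have : a * (a + 1)⁻¹ - 1 = -(a + 1)⁻¹ := by field_simp; ring
    rw [this, neg_mem_iff]
    intro _
    rw [ord_inv x h1, hx.2]
    omega
  · have hy' := haS y (Finset.mem_erase.mpr ⟨hyx, hy⟩)
    have h2 : v.ord y (1 + a) = v.ord y 1 :=
      (ord_add_eq_of_lt one_ne_zero (by rwa [ord_one])).2
    rw [v.ord_mul y ha (inv_ne_zero h1), ord_inv y h1, add_comm a, h2, ord_one]
    omega

/-- Weak approximation, for one prescribed leading coefficient: a function `h` with order at least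
`n x` at `x` is approximated at `x` by a function with order at least `n` at all places of `S`. -/
theorem exists_sub_mem_orderGE (x : ι) (S : Finset ι) (n : ι → ℤ) {h : F}
    (hh : h ∈ v.orderGE x (n x)) :
    ∃ u : F, (∀ y ∈ S, u ∈ v.orderGE y (n y)) ∧ u - h ∈ v.orderGE x (n x + 1) := by
  obtain ⟨e, hex, heS⟩ := hv.exists_sub_one_mem_orderGE x S
  obtain ⟨N, hN⟩ : ∃ N : ℕ, ∀ y ∈ S, (n y - v.ord y h).natAbs ≤ N :=
    ⟨S.sup fun y ↦ (n y - v.ord y h).natAbs, fun y hy ↦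
      Finset.le_sup (f := fun y ↦ (n y - v.ord y h).natAbs) hy⟩
  have he0 : e ∈ v.orderGE x 0 := by
    simpa using add_mem (orderGE_anti x zero_le_one hex) (one_mem_orderGE x)
  have heN : e ^ N - 1 ∈ v.orderGE x 1 := by
    rw [← mul_geom_sum e N, ← add_zero (1 : ℤ)]
    refine mul_mem_orderGE hex (sum_mem fun i _ ↦ ?_)
    simpa using pow_mem_orderGE he0 i
  have hx : h * e ^ N - h ∈ v.orderGE x (n x + 1) := by
    rw [← mul_sub_one]
    exact mul_mem_orderGE hh heN
  refine ⟨h * e ^ N, fun y hy ↦ ?_, hx⟩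
  by_cases hyx : y = x
  · subst hyx
    simpa using add_mem (orderGE_anti y (by omega) hx) hh
  · have h1 := hN y hy
    exact orderGE_anti y (by omega)
      (mul_mem_orderGE (m := v.ord y h) (fun _ ↦ le_rfl) (pow_mem_orderGE (heS y hy hyx) N))

/-! ### Dimension counts -/

omit hv in
theorem finiteDimensional_and_finrank_le_of_ker_le {d : ℕ} {A B : Submodule k F}
    [FiniteDimensional k B] (ψ : A →ₗ[k] (Fin d → k)) (h : ∀ f, ψ f = 0 → (f : F) ∈ B) :
    FiniteDimensional k A ∧ finrank k A ≤ d + finrank k B := by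
  let j : LinearMap.ker ψ →ₗ[k] B :=
    LinearMap.codRestrict B (A.subtype ∘ₗ (LinearMap.ker ψ).subtype) fun f ↦ h f.1 f.2
  have hj : Function.Injective j := fun f g h ↦ Subtype.ext (Subtype.ext congr(($h : F)))
  have : FiniteDimensional k (LinearMap.ker ψ) := FiniteDimensional.of_injective j hj
  have : FiniteDimensional k (A ⧸ LinearMap.ker ψ) := .equiv ψ.quotKerEquivRange.symm
  have hA : FiniteDimensional k A := .of_submodule_quotient (LinearMap.ker ψ)
  have h1 := ψ.finrank_range_add_finrank_ker
  have h2 := LinearMap.finrank_le_finrank_of_injective hj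
  have h3 : finrank k (LinearMap.range ψ) ≤ d := by simpa using (LinearMap.range ψ).finrank_le
  exact ⟨hA, by omega⟩

/-- The Riemann-Roch space of an effective divisor, here a multiset of places, exceeds that of zero
by at most the degree: each further place `x` raises the dimension by at most `deg x`. -/
theorem finrank_space_count_le [DecidableEq ι] (S : Multiset ι) :
    FiniteDimensional k (v.space fun x ↦ (S.count x : ℤ)) ∧
      finrank k (v.space fun x ↦ (S.count x : ℤ)) ≤ (S.map deg).sum + finrank k (v.space 0) := by
  induction S using Multiset.induction_on with
  | empty =>
    have h : (fun x ↦ ((0 : Multiset ι).count x : ℤ)) = 0 := by ext; simp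
    rw [h]
    exact ⟨hv.finite_constants, by simp⟩
  | cons x S ih =>
    obtain ⟨h1, h2⟩ := ih
    obtain ⟨φ, -, hφ⟩ := hv.exists_leadingCoeff x (-((x ::ₘ S).count x : ℤ))
    have h3 := finiteDimensional_and_finrank_le_of_ker_le
      (B := v.space fun y ↦ (S.count y : ℤ))
      (φ ∘ₗ Submodule.inclusion
        (fun f (hf : f ∈ v.space fun y ↦ ((x ::ₘ S).count y : ℤ)) ↦ mem_space.mp hf x)) (by
        rintro ⟨f, hf⟩ hfφ
        refine mem_space.mpr fun y ↦ ?_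
        by_cases hyx : y = x
        · subst hyx
          simpa using (hφ _).mp hfφ
        · simpa [Multiset.count_cons_of_ne hyx] using mem_space.mp hf y)
    refine ⟨h3.1, h3.2.trans ?_⟩
    rw [Multiset.map_cons, Multiset.sum_cons, add_assoc]
    exact Nat.add_le_add_left h2 _

/-- The functions without a pole in `Z` contain a space of dimension `deg Z` in which only zero
vanishes along the divisor `Z`. -/
theorem exists_disjoint_orderGE_count [DecidableEq ι] (Z : Multiset ι) :
    ∃ U : Submodule k F, FiniteDimensional k U ∧ finrank k U = (Z.map deg).sum ∧
      (∀ x ∈ Z, U ≤ v.orderGE x 0) ∧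
      ∀ u ∈ U, (∀ x ∈ Z, u ∈ v.orderGE x (Z.count x)) → u = 0 := by
  -- the induction runs over the multisets of places of a fixed finite set `S`
  suffices H : ∀ S : Finset ι, ∀ Y : Multiset ι, Y.toFinset ⊆ S →
      ∃ U : Submodule k F, FiniteDimensional k U ∧ finrank k U = (Y.map deg).sum ∧
        (∀ x ∈ S, U ≤ v.orderGE x 0) ∧
        ∀ u ∈ U, (∀ x ∈ S, u ∈ v.orderGE x (Y.count x)) → u = 0 by
    simpa using H Z.toFinset Z subset_rfl
  intro S Y
  induction Y using Multiset.induction_on with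
  | empty =>
    exact fun _ ↦ ⟨⊥, inferInstance, by simp, by simp, by simp⟩
  | cons x Y ih =>
    intro hS
    rw [Multiset.toFinset_cons, Finset.insert_subset_iff] at hS
    obtain ⟨U, hU, hUd, hU0, hUY⟩ := ih hS.2
    obtain ⟨φ, hφs, hφ⟩ := hv.exists_leadingCoeff x (Y.count x)
    let W : Submodule k F := ⨅ y ∈ S, v.orderGE y (Y.count y)
    have hW : ∀ {u : F}, u ∈ W ↔ ∀ y ∈ S, u ∈ v.orderGE y (Y.count y) := by
      simp [W, Submodule.mem_iInf]
    let ψ : W →ₗ[k] (Fin (deg x) → k) :=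
      φ ∘ₗ Submodule.inclusion (fun f hf ↦ hW.mp hf x hS.1)
    have hψ : Function.Surjective ψ := fun c ↦ by
      obtain ⟨h, rfl⟩ := hφs c
      obtain ⟨u, huS, hu⟩ := hv.exists_sub_mem_orderGE x S (fun y ↦ (Y.count y : ℤ)) h.2
      refine ⟨⟨u, hW.mpr huS⟩, ?_⟩
      rw [← sub_eq_zero]
      change φ ⟨u, _⟩ - φ h = 0
      rw [← map_sub, hφ]
      exact hu
    obtain ⟨s, hs⟩ := ψ.exists_rightInverse_of_surjective (LinearMap.range_eq_top.mpr hψ)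
    have hs' : ∀ c, ψ (s c) = c := fun c ↦ congr($hs c)
    let t : (Fin (deg x) → k) →ₗ[k] F := W.subtype ∘ₗ s
    have ht : ∀ c, t c ∈ W := fun c ↦ (s c).2
    have ht0 : ∀ c, t c ∈ v.orderGE x (Y.count x + 1) → c = 0 := fun c hc ↦ by
      rw [← hs' c]
      exact (hφ _).mpr hc
    have htinj : Function.Injective t := by
      rw [injective_iff_map_eq_zero]
      exact fun c hc ↦ ht0 c (hc ▸ zero_mem _)
    have hdisj : U ⊓ LinearMap.range t = ⊥ := by
      rw [eq_bot_iff]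
      rintro _ ⟨h1, ⟨c, rfl⟩⟩
      exact hUY _ h1 (hW.mp (ht c))
    refine ⟨U ⊔ LinearMap.range t, inferInstance, ?_, fun y hy ↦ sup_le (hU0 y hy) ?_, ?_⟩
    · have h1 := Submodule.finrank_sup_add_finrank_inf_eq U (LinearMap.range t)
      rw [hdisj, finrank_bot, LinearMap.finrank_range_of_inj htinj, Module.finrank_fin_fun,
        hUd] at h1
      rw [Multiset.map_cons, Multiset.sum_cons]
      omega
    · rintro _ ⟨c, rfl⟩
      exact orderGE_anti y (by positivity) (hW.mp (ht c) y hy)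
    · intro f hf hfS
      obtain ⟨u, hu, _, ⟨c, rfl⟩, rfl⟩ := Submodule.mem_sup.mp hf
      have h1 : u + t c ∈ W := hW.mpr fun y hy ↦
        orderGE_anti y (by exact_mod_cast Multiset.count_le_count_cons y x Y) (hfS y hy)
      have h2 : u = 0 := hUY u hu (hW.mp (by simpa using sub_mem h1 (ht c)))
      subst h2
      rw [zero_add] at hfS ⊢
      have h3 := hfS x hS.1
      rw [Multiset.count_cons_self, Nat.cast_add, Nat.cast_one] at h3
      rw [ht0 c h3, map_zero]

theorem exists_mem_space_count [DecidableEq ι] (f : F) :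
    ∃ S : Multiset ι, f ∈ v.space fun x ↦ (S.count x : ℤ) := by
  let N : ι →₀ ℕ := .onFinset (hv.finite_poles f).toFinset (fun x ↦ (-v.ord x f).toNat) (by
    intro x hx
    rw [Set.Finite.mem_toFinset, Set.mem_ofPred_eq]
    omega)
  refine ⟨Finsupp.toMultiset N, mem_space.mpr fun x _ ↦ ?_⟩
  rw [Finsupp.count_toMultiset, Finsupp.onFinset_apply]
  omega

theorem exists_le_space_count [DecidableEq ι] (U : Submodule k F) [FiniteDimensional k U] :
    ∃ S : Multiset ι, U ≤ v.space fun x ↦ (S.count x : ℤ) := by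
  obtain ⟨T, hT⟩ := (Submodule.fg_top U).mp Module.Finite.fg_top |>.imp fun _ h ↦ h
  choose S hS using hv.exists_mem_space_count
  refine ⟨∑ f ∈ T, S f, ?_⟩
  rw [← hT, Submodule.span_le]
  intro f hf
  refine mem_space.mpr fun x ↦ orderGE_anti x ?_ (mem_space.mp (hS f) x)
  rw [Multiset.count_sum']
  have := Finset.single_le_sum_of_canonicallyOrdered (f := fun f ↦ (S f).count x) hf
  omega

omit hv in
/-- If only the zero of `U` vanishes along `Z`, then `U` is linearly disjoint over `k` from the
powers of a function `f` vanishing along `Z`. -/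
theorem eq_zero_of_sum_pow_mul_eq_zero [DecidableEq ι] {Z : Multiset ι} {U : Submodule k F}
    (hU0 : ∀ x ∈ Z, U ≤ v.orderGE x 0)
    (hUZ : ∀ u ∈ U, (∀ x ∈ Z, u ∈ v.orderGE x (Z.count x)) → u = 0)
    {f : F} (hf : f ≠ 0) (hfZ : ∀ x ∈ Z, f ∈ v.orderGE x (Z.count x)) (l : ℕ)
    (u : Fin l → U) (hu : ∑ i : Fin l, f ^ (i : ℕ) * (u i : F) = 0) : u = 0 := by
  induction l with
  | zero => exact Subsingleton.elim _ _
  | succ l ih =>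
    have h1 : ∑ i : Fin (l + 1), f ^ (i : ℕ) * (u i : F) =
        u 0 + f * ∑ i : Fin l, f ^ (i : ℕ) * (u i.succ : F) := by
      simp [Fin.sum_univ_succ, Finset.mul_sum, pow_succ', mul_assoc]
    rw [h1] at hu
    have h2 : u 0 = 0 := by
      refine Subtype.ext (hUZ _ (u 0).2 fun x hx ↦ ?_)
      rw [eq_neg_of_add_eq_zero_left hu, neg_mem_iff, ← add_zero (Multiset.count x Z : ℤ)]
      refine mul_mem_orderGE (hfZ x hx) (sum_mem fun i _ ↦ ?_)
      have h3 : f ∈ v.orderGE x 0 := orderGE_anti x (by positivity) (hfZ x hx)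
      simpa using mul_mem_orderGE (pow_mem_orderGE h3 i) (hU0 x hx (u i.succ).2)
    rw [h2, Submodule.coe_zero, zero_add] at hu
    have h4 := ih (fun i ↦ u i.succ) ((mul_eq_zero.mp hu).resolve_left hf)
    funext i
    refine Fin.cases h2 (fun i ↦ ?_) i
    exact congr_fun h4 i

/-- A nonzero function with poles at most `P` that vanishes along `Z` forces `deg Z ≤ deg P`: the
products of its first `l` powers with a space of dimension `deg Z` span a space of dimension
`l * deg Z` inside the Riemann-Roch space of a divisor of degree `l * deg P + O(1)`. -/
theorem sum_deg_le [DecidableEq ι] {Z P : Multiset ι} {f : F} (hf : f ≠ 0)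
    (hfZ : ∀ x ∈ Z, f ∈ v.orderGE x (Z.count x))
    (hfP : f ∈ v.space fun x ↦ (P.count x : ℤ)) : (Z.map deg).sum ≤ (P.map deg).sum := by
  obtain ⟨U, hU, hUd, hU0, hUZ⟩ := hv.exists_disjoint_orderGE_count Z
  obtain ⟨S, hS⟩ := hv.exists_le_space_count U
  let c := (S.map deg).sum + finrank k (v.space 0)
  have key (l : ℕ) : l * (Z.map deg).sum ≤ l * (P.map deg).sum + c := by
    let A := v.space fun x ↦ ((l • P + S).count x : ℤ)
    obtain ⟨hA, hAd⟩ := hv.finrank_space_count_le (l • P + S)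
    let T : (Fin l → U) →ₗ[k] F :=
      ∑ i : Fin l, (LinearMap.mulLeft k (f ^ (i : ℕ))) ∘ₗ U.subtype ∘ₗ LinearMap.proj i
    have hTapp (u : Fin l → U) : T u = ∑ i : Fin l, f ^ (i : ℕ) * (u i : F) := by
      simp [T, LinearMap.sum_apply]
    have hTA (u : Fin l → U) : T u ∈ A := by
      rw [hTapp]
      refine sum_mem fun i _ ↦ mem_space.mpr fun x ↦ ?_
      refine orderGE_anti x ?_
        (mul_mem_orderGE (pow_mem_orderGE (mem_space.mp hfP x) i) (mem_space.mp (hS (u i).2) x))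
      have : (i : ℤ) * P.count x ≤ l * P.count x :=
        mul_le_mul_of_nonneg_right (by exact_mod_cast i.2.le) (by positivity)
      rw [Multiset.count_add, Multiset.count_nsmul]
      push_cast
      linarith
    have hTinj : Function.Injective (T.codRestrict A hTA) := by
      rw [injective_iff_map_eq_zero]
      intro u hu
      refine eq_zero_of_sum_pow_mul_eq_zero hU0 hUZ hf hfZ l u ?_
      rw [← hTapp]
      exact congr(($hu : F))
    have h1 := LinearMap.finrank_le_finrank_of_injective hTinj
    rw [Module.finrank_pi_fintype, Finset.sum_const, Finset.card_univ, Fintype.card_fin, hUd,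
      smul_eq_mul] at h1
    refine h1.trans (hAd.trans ?_)
    rw [Multiset.map_add, Multiset.sum_add, Multiset.map_nsmul, Multiset.sum_nsmul, smul_eq_mul,
      add_assoc]
  by_contra! h
  -- for `l = c + 1` a gap of one between the degrees outweighs the constant `c`
  have h1 := key (c + 1)
  have h2 : (c + 1) * ((P.map deg).sum + 1) ≤ (c + 1) * (Z.map deg).sum :=
    Nat.mul_le_mul_left _ h
  rw [mul_add] at h2
  omega

/-- A divisor with a nonzero function in its Riemann-Roch space has nonnegative degree. -/
theorem degree_nonneg (D : ι →₀ ℤ) {f : F} (hf : f ≠ 0) (hfD : f ∈ v.space D) :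
    0 ≤ D.sum fun x n ↦ n * (deg x : ℤ) := by
  classical
  -- the positive and the negative part of `D`
  let P : ι →₀ ℕ := D.mapRange Int.toNat rfl
  let Z : ι →₀ ℕ := D.mapRange (fun n ↦ (-n).toNat) rfl
  have hsum (E : ι →₀ ℕ) (hE : E.support ⊆ D.support) :
      (((Finsupp.toMultiset E).map deg).sum : ℤ) = ∑ x ∈ D.support, (E x : ℤ) * deg x := by
    rw [Finset.sum_multiset_map_count, Finsupp.toFinset_toMultiset,
      Finset.sum_subset hE fun x _ hx ↦ by simp [Finsupp.notMem_support_iff.mp hx]]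
    simp [Finsupp.count_toMultiset]
  have hPD : P.support ⊆ D.support := Finsupp.support_mapRange
  have hZD : Z.support ⊆ D.support := Finsupp.support_mapRange
  have hPZ := hv.sum_deg_le (Z := Finsupp.toMultiset Z) (P := Finsupp.toMultiset P) hf
    (fun x hx ↦ orderGE_anti x ?_ (mem_space.mp hfD x))
    (mem_space.mpr fun x ↦ orderGE_anti x ?_ (mem_space.mp hfD x))
  · rw [← Nat.cast_le (α := ℤ)] at hPZ
    rw [hsum P hPD, hsum Z hZD] at hPZ
    refine (sub_nonneg.mpr hPZ).trans_eq ?_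
    rw [← Finset.sum_sub_distrib]
    refine Finset.sum_congr rfl fun x _ ↦ ?_
    rw [← sub_mul]
    congr 1
    simp only [P, Z, Finsupp.mapRange_apply]
    omega
  · have hx' : Z x ≠ 0 := by simpa using hx
    simp only [Z, Finsupp.mapRange_apply] at hx'
    simp only [Z, Finsupp.count_toMultiset, Finsupp.mapRange_apply]
    omega
  · simp only [P, Finsupp.count_toMultiset, Finsupp.mapRange_apply]
    omega

end IsGlobal
end OrderFamily

/-! ### Orders of vanishing on a curve -/

namespace Curve

variable {k : Type u} [Field k] (C : Curve k)

theorem ord_of_isUnit (x : C.ClosedPoint) {s : C.LocalRing x.1} (hs : IsUnit s) :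
    C.ord x (algebraMap (C.LocalRing x.1) C.FunctionField s) = 0 := by
  have hx := C.coheight_eq_one x.2
  have : Ring.KrullDimLE 1 (C.X.presheaf.stalk x.1) := krullDimLE_of_coheight_le hx.le
  rw [ord, Scheme.ord_eq_iff hx (by simpa using hs.ne_zero)]
  exact Ring.ordFrac_of_isUnit hs

theorem ord_of_irreducible (x : C.ClosedPoint) {t : C.LocalRing x.1} (ht : Irreducible t) :
    C.ord x (algebraMap (C.LocalRing x.1) C.FunctionField t) = 1 := by
  have := C.isDiscreteValuationRing x.2
  have hx := C.coheight_eq_one x.2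
  rw [ord, Scheme.ord_eq_iff hx (by simpa using ht.ne_zero)]
  exact Ring.ordFrac_irreducible ht

/-- The orders of vanishing at the closed points of a curve. -/
noncomputable def orderFamily : OrderFamily k C.FunctionField C.ClosedPoint where
  ord := C.ord
  ord_mul _ _ _ hf hg := Scheme.ord_mul hf hg
  ord_add x _ _ h := C.ord_add x h
  ord_algebraMap x _ hc := C.ord_algebraMap x hc

theorem orderFamily_ord (x : C.ClosedPoint) (f : C.FunctionField) :
    C.orderFamily.ord x f = C.ord x f := rfl

theorem riemannRochSpace_eq_space (D : C.Divisor) :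
    C.riemannRochSpace D = C.orderFamily.space D := by
  ext f
  rw [OrderFamily.mem_space]
  exact ⟨fun h x h0 ↦ h h0 x, fun h h0 x ↦ h x h0⟩

theorem ord_zpow_of_irreducible (x : C.ClosedPoint) {t : C.LocalRing x.1} (ht : Irreducible t)
    (n : ℤ) : C.ord x (algebraMap (C.LocalRing x.1) C.FunctionField t ^ n) = n := by
  have ht0 : algebraMap (C.LocalRing x.1) C.FunctionField t ≠ 0 := by simpa using ht.ne_zero
  have hpow (n : ℕ) : C.ord x (algebraMap (C.LocalRing x.1) C.FunctionField t ^ n) = n := by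
    rw [← orderFamily_ord, OrderFamily.ord_pow x ht0, orderFamily_ord,
      C.ord_of_irreducible x ht, mul_one]
  obtain ⟨m, rfl | rfl⟩ := n.eq_nat_or_neg
  · rw [zpow_natCast, hpow]
  · rw [zpow_neg, zpow_natCast, ← orderFamily_ord, OrderFamily.ord_inv x (pow_ne_zero m ht0),
      orderFamily_ord, hpow]

/-- A nonzero function is a unit times a power of a uniformizer `t`. -/
theorem exists_eq_isUnit_mul_zpow (x : C.ClosedPoint) {t : C.LocalRing x.1} (ht : Irreducible t)
    {f : C.FunctionField} (hf : f ≠ 0) :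
    ∃ s : C.LocalRing x.1, IsUnit s ∧ f = algebraMap (C.LocalRing x.1) C.FunctionField s *
      algebraMap (C.LocalRing x.1) C.FunctionField t ^ C.ord x f := by
  have := C.isDiscreteValuationRing x.2
  have hx := C.coheight_eq_one x.2
  have h1 := (Scheme.ord_eq_iff hx hf (n := C.ord x f)).mp rfl
  obtain ⟨u, hu⟩ := Ring.associated_of_ordFrac_eq (R := C.LocalRing x.1)
    (algebraMap (C.LocalRing x.1) C.FunctionField t ^ C.ord x f) f (by
      rw [map_zpow₀, Ring.ordFrac_irreducible ht]
      refine Eq.trans ?_ h1.symm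
      rw [← WithZero.exp_zsmul]
      simp [WithZero.exp])
  refine ⟨u, u.isUnit, ?_⟩
  rw [← Algebra.smul_def, ← Units.smul_def, hu]

theorem mem_orderGE_zero_iff (x : C.ClosedPoint) {f : C.FunctionField} :
    f ∈ C.orderFamily.orderGE x 0 ↔
      f ∈ Set.range (algebraMap (C.LocalRing x.1) C.FunctionField) := by
  have := C.isDiscreteValuationRing x.2
  obtain ⟨t, ht⟩ := IsDiscreteValuationRing.exists_irreducible (C.LocalRing x.1)
  refine ⟨fun h ↦ ?_, ?_⟩
  · by_cases hf : f = 0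
    · exact ⟨0, by simp [hf]⟩
    obtain ⟨s, -, hs⟩ := C.exists_eq_isUnit_mul_zpow x ht hf
    obtain ⟨n, hn⟩ := Int.eq_ofNat_of_zero_le (h hf)
    rw [orderFamily_ord] at hn
    refine ⟨s * t ^ n, ?_⟩
    rw [hs, hn, map_mul, map_pow, zpow_natCast]
  · rintro ⟨s, rfl⟩ h
    have hs : s ≠ 0 := by rintro rfl; simp at h
    obtain ⟨n, u, rfl⟩ := IsDiscreteValuationRing.eq_unit_mul_pow_irreducible hs ht
    rw [orderFamily_ord, map_mul, map_pow, ← orderFamily_ord,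
      OrderFamily.ord_mul _ x (by simp) (pow_ne_zero n (by simpa using ht.ne_zero)),
      orderFamily_ord, orderFamily_ord, C.ord_of_isUnit x u.isUnit, ← zpow_natCast,
      C.ord_zpow_of_irreducible x ht]
    positivity

theorem algebraMap_mem_orderGE_one_iff (x : C.ClosedPoint) {s : C.LocalRing x.1} :
    algebraMap (C.LocalRing x.1) C.FunctionField s ∈ C.orderFamily.orderGE x 1 ↔
      s ∈ IsLocalRing.maximalIdeal (C.LocalRing x.1) := by
  rw [IsLocalRing.mem_maximalIdeal, mem_nonunits_iff]
  refine ⟨fun h hs ↦ ?_, fun h h0 ↦ ?_⟩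
  · have h1 := h (by simpa using hs.ne_zero)
    rw [orderFamily_ord, C.ord_of_isUnit x hs] at h1
    omega
  · have := C.isDiscreteValuationRing x.2
    have h1 := (C.mem_orderGE_zero_iff x).mpr ⟨s, rfl⟩ h0
    by_contra! h2
    obtain ⟨t, ht⟩ := IsDiscreteValuationRing.exists_irreducible (C.LocalRing x.1)
    obtain ⟨u, hu, hsu⟩ := C.exists_eq_isUnit_mul_zpow x ht h0
    rw [orderFamily_ord] at h1 h2
    rw [show C.ord x (algebraMap (C.LocalRing x.1) C.FunctionField s) = 0 by omega, zpow_zero,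
      mul_one] at hsu
    exact h (FaithfulSMul.algebraMap_injective _ _ hsu ▸ hu)

/-! ### Residue fields -/

/-- The residue field of the only point of `Spec k` is `k`. -/
theorem bijective_algebraMap_residueField (y : Spec (.of k)) :
    Function.Bijective ((Scheme.ΓSpecIso (.of k)).inv ≫
      (Spec (.of k)).presheaf.germ ⊤ y trivial ≫ (Spec (.of k)).residue y).hom := by
  rw [← Scheme.Spec.algebraMap_residueFieldIso_inv]
  have hy : y.asIdeal.IsMaximal := Ideal.IsPrime.isMaximal' (R := k) (I := y.asIdeal) y.isPrime
  have h1 : Function.Bijective (algebraMap k y.asIdeal.ResidueField) :=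
    ⟨(algebraMap k y.asIdeal.ResidueField).injective,
      y.asIdeal.bijective_algebraMap_quotient_residueField.surjective.comp
        Ideal.Quotient.mk_surjective⟩
  exact (Scheme.Spec.residueFieldIso (.of k) y).symm.commRingCatIsoToRingEquiv.bijective.comp h1

theorem residueFieldMap_algebraMap (x : C.X) (c : k) :
    (C.str.residueFieldMap x).hom (((Scheme.ΓSpecIso (.of k)).inv ≫
      (Spec (.of k)).presheaf.germ ⊤ (C.str x) trivial ≫ (Spec (.of k)).residue (C.str x)).hom c) =
      algebraMap k (IsLocalRing.ResidueField (C.LocalRing x)) c := by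
  have := Scheme.Γevaluation_naturality_apply C.str x ((Scheme.ΓSpecIso (.of k)).inv.hom c)
  exact this

theorem finrank_residueField (x : C.X) :
    finrank k (IsLocalRing.ResidueField (C.LocalRing x)) = C.str.residueDegree x := by
  rw [Scheme.Hom.residueDegree]
  let := (C.str.residueFieldMap x).hom.toAlgebra
  exact Algebra.finrank_eq_of_equiv_equiv
    (RingEquiv.ofBijective _ (bijective_algebraMap_residueField (C.str x))) (RingEquiv.refl _)
    (RingHom.ext fun c ↦ C.residueFieldMap_algebraMap x c)

theorem fromSpecStalk_str (x : C.X) :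
    C.X.fromSpecStalk x ≫ C.str = Spec.map (CommRingCat.ofHom (algebraMap k (C.LocalRing x))) := by
  rw [← cancel_mono (Spec (.of k)).toSpecΓ, Category.assoc, Scheme.toSpecΓ_naturality,
    Scheme.fromSpecStalk_toSpecΓ_assoc, ← SpecMap_ΓSpecIso_hom, ← Spec.map_comp, ← Spec.map_comp]
  congr 1
  rw [← Iso.inv_comp_eq]
  rfl

theorem finite_residueField (x : C.ClosedPoint) :
    FiniteDimensional k (IsLocalRing.ResidueField (C.LocalRing x.1)) := by
  have := isClosed_singleton_iff_isClosedImmersion.mp x.2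
  have hf := (isFinite_iff_locallyOfFiniteType_of_jacobsonSpace
    (f := C.X.fromSpecResidueField x.1 ≫ C.str)).mpr inferInstance
  rw [Scheme.fromSpecResidueField, Category.assoc, fromSpecStalk_str, ← Spec.map_comp,
    IsFinite.SpecMap_iff] at hf
  exact hf

theorem residueDegree_pos (x : C.ClosedPoint) : 0 < C.str.residueDegree x.1 := by
  have := C.finite_residueField x
  rw [← C.finrank_residueField]
  exact finrank_pos

/-- The leading coefficient at `x` of a function of order at least `n` is the residue of its
quotient by the `n`-th power of a uniformizer. -/
theorem exists_leadingCoeff (x : C.ClosedPoint) (n : ℤ) :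
    ∃ φ : C.orderFamily.orderGE x n →ₗ[k] (Fin (C.str.residueDegree x.1) → k),
      Function.Surjective φ ∧
        ∀ f, φ f = 0 ↔ (f : C.FunctionField) ∈ C.orderFamily.orderGE x (n + 1) := by
  have := C.isDiscreteValuationRing x.2
  have := C.finite_residueField x
  obtain ⟨t, ht⟩ := IsDiscreteValuationRing.exists_irreducible (C.LocalRing x.1)
  let ι : C.LocalRing x.1 →ₗ[k] C.FunctionField :=
    (IsScalarTower.toAlgHom k (C.LocalRing x.1) C.FunctionField).toLinearMap
  have hι : Function.Injective ι := FaithfulSMul.algebraMap_injective _ _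
  let ρ : C.LocalRing x.1 →ₗ[k] IsLocalRing.ResidueField (C.LocalRing x.1) :=
    (IsScalarTower.toAlgHom k (C.LocalRing x.1) _).toLinearMap
  have hρ (s) : ρ s = 0 ↔ ι s ∈ C.orderFamily.orderGE x 1 :=
    (IsLocalRing.residue_eq_zero_iff s).trans (C.algebraMap_mem_orderGE_one_iff x).symm
  let τ : C.FunctionField := algebraMap (C.LocalRing x.1) C.FunctionField t
  have hτ0 : τ ≠ 0 := by simpa [τ] using ht.ne_zero
  have hτ (m : ℤ) : C.ord x (τ ^ m) = m := C.ord_zpow_of_irreducible x ht m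
  have hmul {m l : ℤ} {f : C.FunctionField} (hf : f ∈ C.orderFamily.orderGE x m) :
      τ ^ l * f ∈ C.orderFamily.orderGE x (l + m) :=
    OrderFamily.mul_mem_orderGE (fun _ ↦ (hτ l).ge) hf
  have hrange (f : C.orderFamily.orderGE x n) :
      (LinearMap.mulLeft k (τ ^ (-n)) ∘ₗ Submodule.subtype _) f ∈ LinearMap.range ι := by
    have h1 := hmul (l := -n) f.2
    rw [neg_add_cancel, C.mem_orderGE_zero_iff] at h1
    exact h1
  let σ : C.orderFamily.orderGE x n →ₗ[k] C.LocalRing x.1 :=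
    (LinearEquiv.ofInjective ι hι).symm.toLinearMap ∘ₗ LinearMap.codRestrict _ _ hrange
  have hσ (f) : ι (σ f) = τ ^ (-n) * f :=
    congr(($((LinearEquiv.ofInjective ι hι).apply_symm_apply ⟨_, hrange f⟩) : C.FunctionField))
  let e : IsLocalRing.ResidueField (C.LocalRing x.1) ≃ₗ[k] (Fin (C.str.residueDegree x.1) → k) :=
    LinearEquiv.ofFinrankEq _ _ (by rw [C.finrank_residueField, Module.finrank_fin_fun])
  refine ⟨e.toLinearMap ∘ₗ ρ ∘ₗ σ, ?_, fun f ↦ ?_⟩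
  · refine e.surjective.comp (IsLocalRing.residue_surjective.comp fun s ↦ ?_)
    have h1 := hmul (l := n) ((C.mem_orderGE_zero_iff x).mpr ⟨s, rfl⟩)
    rw [add_zero] at h1
    refine ⟨⟨_, h1⟩, hι ?_⟩
    refine (hσ _).trans ?_
    rw [← mul_assoc, ← zpow_add₀ hτ0, neg_add_cancel, zpow_zero, one_mul]
    rfl
  · rw [LinearMap.comp_apply, LinearEquiv.coe_coe, e.map_eq_zero_iff, LinearMap.comp_apply, hρ, hσ]
    refine ⟨fun h ↦ ?_, fun h ↦ ?_⟩
    · have h1 := hmul (l := n) h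
      rwa [← mul_assoc, ← zpow_add₀ hτ0, add_neg_cancel, zpow_zero, one_mul] at h1
    · simpa using hmul (l := -n) h

end Curve

/-! ### Poles, separatedness and global functions -/

namespace Curve

variable {k : Type u} [Field k] (C : Curve k)

theorem mem_orderGE_zero_of_germ {U : C.X.Opens} [Nonempty U] (s : Γ(C.X, U)) {x : C.ClosedPoint}
    (hx : x.1 ∈ U) : C.X.germToFunctionField U s ∈ C.orderFamily.orderGE x 0 := by
  rw [C.mem_orderGE_zero_iff, ← Scheme.algebraMap_germ_eq_germToFunctionField _ hx]
  exact ⟨_, rfl⟩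

instance isNoetherian : IsNoetherian C.X where
  toCompactSpace := (quasiCompact_iff_compactSpace C.str).mp inferInstance

/-- A proper closed subset of a curve has finitely many closed points: as the closed points have
coheight one, they are generic points of its irreducible components. -/
theorem finite_closedPoint_notMem (U : C.X.Opens) [Nonempty U] :
    {x : C.ClosedPoint | x.1 ∉ U}.Finite := by
  obtain ⟨S, hS, hSc, hSi, hSU⟩ :=
    TopologicalSpace.NoetherianSpace.exists_finite_set_isClosed_irreducible
      (isClosed_compl_iff.mpr U.isOpen)
  have key : ∀ T ∈ S, {x : C.ClosedPoint | x.1 ∈ T}.Subsingleton := by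
    intro T hT
    obtain ⟨z, hz⟩ := QuasiSober.sober (hSi T hT) (hSc T hT)
    have hzU : z ∉ U := fun h ↦ by
      have : z ∈ (U : Set C.X)ᶜ := hSU ▸ ⟨T, hT, hz.mem⟩
      exact this h
    have hη : genericPoint C.X ∈ U :=
      ((genericPoint_spec C.X).mem_open_set_iff U.isOpen).mpr (by simpa using ‹Nonempty U›)
    have h1 : z < genericPoint C.X := by
      refine lt_of_le_not_ge ((genericPoint_spec C.X).specializes trivial) fun h ↦ hzU ?_
      exact (Scheme.le_iff_specializes.mp h).mem_open U.isOpen hη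
    have h2 (x : C.ClosedPoint) (hx : x.1 ∈ T) : x.1 = z := by
      by_contra hne
      have hzx : z ⤳ x.1 := hz.specializes hx
      have h3 : x.1 < z := lt_of_le_not_ge hzx fun h ↦
        hne ((Scheme.le_iff_specializes.mp h).antisymm hzx).eq
      have h4 := Order.coheight_add_one_le h3
      have h5 := Order.coheight_add_one_le h1
      rw [C.coheight_eq_one x.2] at h4
      have h6 : (1 : ℕ∞) + 1 ≤ 1 :=
        (add_le_add_left (le_add_self.trans h5) 1).trans h4
      norm_num at h6
    exact fun x hx y hy ↦ Subtype.ext ((h2 x hx).trans (h2 y hy).symm)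
  refine (hS.biUnion fun T hT ↦ (key T hT).finite).subset fun x hx ↦ ?_
  have : x.1 ∈ ⋃₀ S := hSU ▸ hx
  obtain ⟨T, hT, hxT⟩ := this
  exact Set.mem_biUnion hT hxT

theorem finite_poles (f : C.FunctionField) : {x | C.orderFamily.ord x f < 0}.Finite := by
  by_cases hf : f = 0
  · subst hf
    simp [orderFamily_ord, ord]
  obtain ⟨U, -, s, hU, rfl, -⟩ := exists_isUnit_germ_eq C.X f hf
  exact (C.finite_closedPoint_notMem U).subset fun x hx hxU ↦
    absurd (C.mem_orderGE_zero_of_germ s hxU hf) (not_le.mpr hx)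

/-- By separatedness the local ring of a closed point is not contained in that of another one. -/
theorem exists_ord_neg {x y : C.ClosedPoint} (hxy : x ≠ y) :
    ∃ f : C.FunctionField, f ≠ 0 ∧ 0 ≤ C.orderFamily.ord x f ∧ C.orderFamily.ord y f < 0 := by
  by_contra! H
  have hle (s : C.LocalRing x.1) : algebraMap (C.LocalRing x.1) C.FunctionField s ∈
      (algebraMap (C.LocalRing y.1) C.FunctionField).range := by
    have h1 := (C.mem_orderGE_zero_iff x).mpr ⟨s, rfl⟩
    exact (C.mem_orderGE_zero_iff y).mp fun h ↦ H _ h (h1 h)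
  have hinj : Function.Injective (algebraMap (C.LocalRing y.1) C.FunctionField) :=
    FaithfulSMul.algebraMap_injective _ _
  choose φ₀ hφ using hle
  let φ : C.LocalRing x.1 →+* C.LocalRing y.1 :=
    { toFun := φ₀
      map_one' := hinj (by rw [hφ, map_one, map_one])
      map_zero' := hinj (by rw [hφ, map_zero, map_zero])
      map_mul' := fun a b ↦ hinj (by rw [hφ, map_mul, map_mul, hφ, hφ])
      map_add' := fun a b ↦ hinj (by rw [hφ, map_add, map_add, hφ, hφ]) }
  let ψ : C.X.presheaf.stalk x.1 ⟶ C.X.presheaf.stalk y.1 := CommRingCat.ofHom φ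
  have hη (z : C.X) : genericPoint C.X ⤳ z := (genericPoint_spec C.X).specializes trivial
  let j : Spec C.X.functionField ⟶ Spec (C.X.presheaf.stalk y.1) :=
    Spec.map (C.X.presheaf.stalkSpecializes (hη y.1))
  have hj : IsDominant j :=
    ⟨(PrimeSpectrum.denseRange_comap_iff_ker_le_nilRadical _).mpr
      (((RingHom.injective_iff_ker_eq_bot _).mp hinj).trans_le bot_le)⟩
  have h1 : Spec.map ψ ≫ C.X.fromSpecStalk x.1 = C.X.fromSpecStalk y.1 := by
    refine ext_of_isDominant_of_isSeparated C.str ?_ j ?_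
    · rw [Category.assoc, fromSpecStalk_str, fromSpecStalk_str, ← Spec.map_comp]
      congr 1
      ext c
      apply hinj
      refine (hφ _).trans ?_
      exact (IsScalarTower.algebraMap_apply k (C.LocalRing x.1) C.FunctionField c).symm.trans
        (IsScalarTower.algebraMap_apply k (C.LocalRing y.1) C.FunctionField c)
    · rw [Scheme.SpecMap_stalkSpecializes_fromSpecStalk, ← Category.assoc, ← Spec.map_comp,
        ← Scheme.SpecMap_stalkSpecializes_fromSpecStalk (hη x.1)]
      congr 2
      ext s
      exact hφ s
  have h2 : y.1 ⤳ x.1 := by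
    have h3 : y.1 ∈ Set.range (C.X.fromSpecStalk x.1) := by
      refine ⟨Spec.map ψ (IsLocalRing.closedPoint _), (Scheme.Hom.comp_apply _ _ _).symm.trans ?_⟩
      rw [h1]
      exact Scheme.fromSpecStalk_closedPoint
    rwa [Scheme.range_fromSpecStalk] at h3
  have h4 : x.1 ∈ closure {y.1} := specializes_iff_mem_closure.mp h2
  rw [y.2.closure_eq] at h4
  exact hxy (Subtype.ext h4)

/-- Functions regular at all closed points glue to a global section. -/
theorem exists_globalSection {f : C.FunctionField} (hf : f ∈ C.orderFamily.space 0) :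
    ∃ s : Γ(C.X, ⊤), C.X.presheaf.germ ⊤ (genericPoint C.X) trivial s = f := by
  have hloc (x : C.ClosedPoint) : ∃ (U : C.X.Opens) (_ : x.1 ∈ U) (hU : genericPoint C.X ∈ U)
      (s : Γ(C.X, U)), C.X.presheaf.germ U (genericPoint C.X) hU s = f := by
    obtain ⟨a, ha⟩ := (C.mem_orderGE_zero_iff x).mp (by simpa using OrderFamily.mem_space.mp hf x)
    obtain ⟨U, hxU, s, rfl⟩ := C.X.presheaf.exists_germ_eq a
    have : Nonempty U := ⟨⟨x.1, hxU⟩⟩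
    exact ⟨U, hxU, _, s, (Scheme.algebraMap_germ_eq_germToFunctionField _ hxU s).symm.trans ha⟩
  choose U hxU hηU s hs using hloc
  have hcover : (⊤ : C.X.Opens) ≤ iSup U := by
    intro z _
    obtain ⟨x, hx, hxc⟩ := (isClosed_closure (s := {z})).exists_closed_singleton
      (Set.singleton_nonempty z).closure
    rw [TopologicalSpace.Opens.mem_iSup]
    exact ⟨⟨x, hxc⟩, (specializes_iff_mem_closure.mpr hx).mem_open (U _).isOpen (hxU ⟨x, hxc⟩)⟩
  obtain ⟨t, ht, -⟩ := C.X.sheaf.existsUnique_gluing' U ⊤ (fun x ↦ homOfLE le_top) hcover s (by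
    intro x y
    have hη : genericPoint C.X ∈ U x ⊓ U y := ⟨hηU x, hηU y⟩
    apply germ_injective_of_isIntegral C.X (genericPoint C.X) hη
    refine (C.X.presheaf.germ_res_apply (TopologicalSpace.Opens.infLELeft _ _) _ hη _).trans ?_
    refine Eq.trans ?_
      (C.X.presheaf.germ_res_apply (TopologicalSpace.Opens.infLERight _ _) _ hη _).symm
    rw [hs, hs])
  obtain ⟨x⟩ : Nonempty C.ClosedPoint := by
    obtain ⟨x, -, hx⟩ := isClosed_univ.exists_closed_singleton (X := C.X) Set.univ_nonempty
    exact ⟨x, hx⟩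
  exact ⟨t, ((C.X.presheaf.germ_res_apply (homOfLE le_top) _ (hηU x) t).symm.trans
    (congrArg _ (ht x))).trans (hs x)⟩

theorem finite_constants : FiniteDimensional k (C.orderFamily.space 0) := by
  let j := (Scheme.ΓSpecIso (.of k)).inv ≫ C.str.appTop
  have hj : j.hom.Finite := (finite_appTop_of_universallyClosed k C.str).comp
    (.of_surjective _ (Scheme.ΓSpecIso (.of k)).symm.commRingCatIsoToRingEquiv.surjective)
  let := j.hom.toAlgebra
  have : Module.Finite k Γ(C.X, ⊤) := hj
  let G : Γ(C.X, ⊤) →ₗ[k] C.FunctionField := 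
    { (C.X.presheaf.germ ⊤ (genericPoint C.X) trivial).hom with
      map_smul' := fun c s ↦ by
        rw [Algebra.smul_def, Algebra.smul_def]
        exact map_mul (C.X.presheaf.germ ⊤ (genericPoint C.X) trivial).hom _ _ }
  have hle : C.orderFamily.space 0 ≤ LinearMap.range G := fun f hf ↦ C.exists_globalSection hf
  exact Submodule.finiteDimensional_of_le hle

theorem orderFamily_isGlobal :
    C.orderFamily.IsGlobal fun x ↦ C.str.residueDegree x.1 where
  exists_leadingCoeff := C.exists_leadingCoeff
  finite_poles := C.finite_poles
  exists_ord_neg := C.exists_ord_neg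
  finite_constants := C.finite_constants

theorem degree_nonneg (D : C.Divisor) {f : C.FunctionField} (hf : f ≠ 0)
    (hfD : f ∈ C.riemannRochSpace D) : 0 ≤ C.degree D :=
  C.orderFamily_isGlobal.degree_nonneg D hf (C.riemannRochSpace_eq_space D ▸ hfD)

end Curve

/-! ### Evaluation at rational points -/

namespace Curve

variable {k : Type u} [Field k] {C : Curve k}

/-- The value at a rational point, as a ring homomorphism `𝒪_{X,P} → k`. -/
noncomputable def RationalPoint.valueHom (P : C.RationalPoint) :
    C.LocalRing P.toClosedPoint.1 →+* k :=
  (Scheme.stalkClosedPointTo P.1).hom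

instance RationalPoint.isLocalHom_valueHom (P : C.RationalPoint) : IsLocalHom P.valueHom :=
  Scheme.isLocalHom_stalkClosedPointTo' P.1

theorem RationalPoint.SpecMap_valueHom_fromSpecStalk (P : C.RationalPoint) :
    Spec.map (CommRingCat.ofHom P.valueHom) ≫ C.X.fromSpecStalk P.toClosedPoint.1 = P.1 :=
  Scheme.Spec_stalkClosedPointTo_fromSpecStalk P.1

theorem RationalPoint.valueHom_algebraMap (P : C.RationalPoint) (c : k) :
    P.valueHom (algebraMap k (C.LocalRing P.toClosedPoint.1) c) = c := by
  have h : CommRingCat.ofHom (algebraMap k (C.LocalRing P.toClosedPoint.1)) ≫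
      CommRingCat.ofHom P.valueHom = 𝟙 (CommRingCat.of k) := by
    apply Spec.map_injective
    rw [Spec.map_comp, ← fromSpecStalk_str, ← Category.assoc, P.SpecMap_valueHom_fromSpecStalk,
      P.2, Spec.map_id]
  exact congr($(h).hom c)

theorem RationalPoint.eval_algebraMap (P : C.RationalPoint) (s : C.LocalRing P.toClosedPoint.1) :
    P.eval (algebraMap (C.LocalRing P.toClosedPoint.1) C.FunctionField s) = P.valueHom s := by
  have h : ∃ t, algebraMap (C.LocalRing P.toClosedPoint.1) C.FunctionField t =
    algebraMap (C.LocalRing P.toClosedPoint.1) C.FunctionField s := ⟨s, rfl⟩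
  have hs : h.choose = s :=
    FaithfulSMul.algebraMap_injective (C.LocalRing P.toClosedPoint.1) C.FunctionField h.choose_spec
  exact (dif_pos h).trans (congrArg P.valueHom hs)

theorem RationalPoint.eval_eq_zero_iff (P : C.RationalPoint) {f : C.FunctionField}
    (hf : f ∈ C.orderFamily.orderGE P.toClosedPoint 0) :
    P.eval f = 0 ↔ f ∈ C.orderFamily.orderGE P.toClosedPoint 1 := by
  obtain ⟨s, rfl⟩ := (C.mem_orderGE_zero_iff _).mp hf
  rw [eval_algebraMap, algebraMap_mem_orderGE_one_iff, IsLocalRing.mem_maximalIdeal,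
    mem_nonunits_iff, ← isUnit_map_iff P.valueHom, isUnit_iff_ne_zero,
    not_not]

/-- Evaluation at a rational point, on the functions regular there. -/
noncomputable def RationalPoint.evalLinear (P : C.RationalPoint) :
    C.orderFamily.orderGE P.toClosedPoint 0 →ₗ[k] k where
  toFun f := P.eval f
  map_add' := by
    rintro ⟨f, hf⟩ ⟨g, hg⟩
    obtain ⟨s, rfl⟩ := (C.mem_orderGE_zero_iff _).mp hf
    obtain ⟨t, rfl⟩ := (C.mem_orderGE_zero_iff _).mp hg
    change P.eval (_ + _) = P.eval _ + P.eval _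
    rw [← map_add, eval_algebraMap, eval_algebraMap, eval_algebraMap, map_add]
  map_smul' := by
    rintro c ⟨f, hf⟩
    obtain ⟨s, rfl⟩ := (C.mem_orderGE_zero_iff _).mp hf
    change P.eval (c • _) = c * P.eval _
    rw [Algebra.smul_def, IsScalarTower.algebraMap_apply k (C.LocalRing P.toClosedPoint.1),
      ← map_mul, eval_algebraMap, eval_algebraMap, map_mul, valueHom_algebraMap]

theorem RationalPoint.mem_orderGE_zero {D : C.Divisor} (P : C.RationalPoint)
    (hP : P.toClosedPoint ∉ D.support) {f : C.FunctionField} (hf : f ∈ C.riemannRochSpace D) :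
    f ∈ C.orderFamily.orderGE P.toClosedPoint 0 := fun h0 ↦ by
  have := hf h0 P.toClosedPoint
  rwa [Finsupp.notMem_support_iff.mp hP, neg_zero] at this

/-- Evaluation of the functions of `ℒ(D)` at rational points outside the support of `D`. -/
noncomputable def evalMap {D : C.Divisor} {L : ℕ} (P : Fin L → C.RationalPoint)
    (hP : ∀ i, (P i).toClosedPoint ∉ D.support) : C.riemannRochSpace D →ₗ[k] (Fin L → k) :=
  LinearMap.pi fun i ↦ (P i).evalLinear ∘ₗ
    Submodule.inclusion fun _ hf ↦ (P i).mem_orderGE_zero (hP i) hf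

theorem range_evalMap {D : C.Divisor} {L : ℕ} (P : Fin L → C.RationalPoint)
    (hP : ∀ i, (P i).toClosedPoint ∉ D.support) :
    (LinearMap.range (evalMap P hP) : Set (Fin L → k)) = goppaCode P D := by
  ext w
  constructor
  · rintro ⟨f, rfl⟩
    exact ⟨f, f.2, rfl⟩
  · rintro ⟨f, hf, rfl⟩
    exact ⟨⟨f, hf⟩, rfl⟩

/-- A rational point is determined by its underlying closed point, as its local homomorphism
`𝒪_{X,x} → k` is a retraction of the constants. -/
theorem RationalPoint.toClosedPoint_injective :
    Function.Injective (toClosedPoint : C.RationalPoint → C.ClosedPoint) := by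
  have H (P : C.RationalPoint) (x : C.X) (hx : P.toClosedPoint.1 = x) :
      ∃ φ : C.LocalRing x →+* k, IsLocalHom φ ∧ (∀ c, φ (algebraMap k (C.LocalRing x) c) = c) ∧
          Spec.map (CommRingCat.ofHom φ) ≫ C.X.fromSpecStalk x = P.1 := by
    subst hx
    exact ⟨P.valueHom, inferInstance, P.valueHom_algebraMap, P.SpecMap_valueHom_fromSpecStalk⟩
  intro P Q hPQ
  obtain ⟨φ, hφ, hφk, hφP⟩ := H P _ rfl
  obtain ⟨ψ, hψ, hψk, hψQ⟩ := H Q P.toClosedPoint.1 (by rw [hPQ])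
  have key : φ = ψ := by
    ext s
    have h1 : φ (s - algebraMap k (C.LocalRing P.toClosedPoint.1) (φ s)) = 0 := by
      rw [map_sub, hφk, sub_self]
    have h2 : ψ (s - algebraMap k (C.LocalRing P.toClosedPoint.1) (φ s)) = 0 := by
      by_contra h
      exact ((hψ.map_nonunit _ (isUnit_iff_ne_zero.mpr h)).map φ).ne_zero h1
    rw [map_sub, hψk, sub_eq_zero] at h2
    exact h2.symm
  exact Subtype.ext (by rw [← hφP, ← hψQ, key])

/-- If there are more points than the degree of `D`, then a function in the kernel of the evaluation
lies in `ℒ(D - P₁ - ⋯ - P_L)`, the Riemann-Roch space of a divisor of negative degree. -/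
theorem evalMap_injective {D : C.Divisor} {L : ℕ} (P : Fin L → C.RationalPoint)
    (hPinj : Function.Injective P) (hP : ∀ i, (P i).toClosedPoint ∉ D.support)
    (hL : C.degree D < L) : Function.Injective (evalMap P hP) := by
  classical
  rw [injective_iff_map_eq_zero]
  rintro ⟨f, hf⟩ hf0
  refine Subtype.ext ?_
  change f = 0
  by_contra h0
  let E : C.Divisor := ∑ i, Finsupp.single (P i).toClosedPoint 1
  have hinj (i j : Fin L) : (P i).toClosedPoint = (P j).toClosedPoint ↔ i = j :=
    (RationalPoint.toClosedPoint_injective.comp hPinj).eq_iff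
  have hE (x : C.ClosedPoint) (hx : ∀ i, (P i).toClosedPoint ≠ x) : E x = 0 := by
    simp [E, Finsupp.finsetSum_apply, hx]
  have hEP (i : Fin L) : E (P i).toClosedPoint = 1 := by
    simp [E, Finsupp.finsetSum_apply, Finsupp.single_apply, hinj]
  have hmem : f ∈ C.riemannRochSpace (D - E) := fun _ x ↦ by
    rw [Finsupp.sub_apply]
    by_cases hx : ∃ i, (P i).toClosedPoint = x
    · obtain ⟨i, rfl⟩ := hx
      rw [hEP, Finsupp.notMem_support_iff.mp (hP i)]
      exact ((P i).eval_eq_zero_iff ((P i).mem_orderGE_zero (hP i) hf)).mp (congr_fun hf0 i) h0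
    · rw [hE x (by simpa using hx), sub_zero]
      exact hf h0 x
  have hdeg := C.degree_nonneg _ h0 hmem
  have hsub : C.degree (D - E) = C.degree D - C.degree E :=
    Finsupp.sum_sub_index fun x a b ↦ sub_mul a b _
  have hdegE : (L : ℤ) ≤ C.degree E := by
    have h1 : C.degree E = ∑ i, C.degree (Finsupp.single (P i).toClosedPoint 1) :=
      (Finsupp.sum_finsetSum_index (fun _ ↦ zero_mul _) fun _ a b ↦ add_mul a b _).symm
    have h2 (i : Fin L) : 1 ≤ C.degree (Finsupp.single (P i).toClosedPoint 1) := by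
      rw [degree, Finsupp.sum_single_index (zero_mul _), one_mul]
      exact_mod_cast C.residueDegree_pos _
    rw [h1]
    simpa using Finset.sum_le_sum fun i (_ : i ∈ Finset.univ) ↦ h2 i
  omega

/-- All members of an increasing zero basis but the first vanish at `P`, so evaluation at `P` is the
first coordinate. -/
theorem repr_zero_eq_eval {D : C.Divisor} {K : ℕ} (hK : 0 < K) (P : C.RationalPoint)
    (hP : P.toClosedPoint ∉ D.support) (B : Basis (Fin K) k (C.riemannRochSpace D))
    (hB : IsIncreasingZeroBasis P B) (hB1 : P.eval (B ⟨0, hK⟩ : C.FunctionField) = 1)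
    (f : C.riemannRochSpace D) : B.repr f ⟨0, hK⟩ = P.eval f := by
  let ev : C.riemannRochSpace D →ₗ[k] k :=
    P.evalLinear ∘ₗ Submodule.inclusion fun _ hf ↦ P.mem_orderGE_zero hP hf
  have hev (j : Fin K) (hj : j ≠ ⟨0, hK⟩) : ev (B j) = 0 := by
    refine (P.eval_eq_zero_iff (P.mem_orderGE_zero hP (B j).2)).mpr fun _ ↦ ?_
    have h0 : (B ⟨0, hK⟩ : C.FunctionField) ≠ 0 := by
      simpa using B.ne_zero ⟨0, hK⟩
    have h1 : 0 ≤ C.ord P.toClosedPoint (B ⟨0, hK⟩) :=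
      P.mem_orderGE_zero hP (B ⟨0, hK⟩).2 h0
    have h2 : C.ord P.toClosedPoint (B ⟨0, hK⟩) < C.ord P.toClosedPoint (B j) :=
      hB (Fin.lt_def.mpr (Nat.pos_of_ne_zero fun h ↦ hj (Fin.ext h)))
    rw [orderFamily_ord]
    omega
  have h := congrArg ev (B.sum_repr f)
  rw [map_sum, Finset.sum_eq_single ⟨0, hK⟩ (fun j _ hj ↦ by rw [map_smul, hev j hj, smul_zero])
    (by simp), map_smul, show ev (B ⟨0, hK⟩) = 1 from hB1, smul_eq_mul, mul_one] at h
  exact h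

end Curve

theorem mainTheorem6 {k : Type u} [Field k] [Finite k] (C : Curve k) (g : ℕ) (hg : C.genus = g)
    (K : ℕ) (hK : 0 < K) (hKg : (g : ℤ) - 1 < K)
    (D : C.Divisor) (hD : C.degree D = (K : ℤ) + g - 1)
    (L : ℕ) (P : Fin L → C.RationalPoint) (hP : Function.Injective P)
    (hsupp : ∀ i, (P i).toClosedPoint ∉ D.support)
    (B₀ : Module.Basis (Fin K) k (C.riemannRochSpace D))
    (B : Fin L → Module.Basis (Fin K) k (C.riemannRochSpace D))
    (hB : ∀ i, Curve.IsIncreasingZeroBasis (P i) (B i))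
    (hB1 : ∀ i, (P i).eval (B i ⟨0, hK⟩ : C.FunctionField) = 1) :
    let G : Matrix (Fin K) (Fin L) k :=
      Curve.firstColumns hK fun i ↦ Curve.changeOfBasis B₀ (B i)
    (Submodule.span k (Set.range G.row) : Set (Fin L → k)) = Curve.goppaCode P D ∧
      (K + g ≤ L → LinearIndependent k G.row) := by
  intro G
  have hrow : G.row = Curve.evalMap P hsupp ∘ B₀ := by
    funext a i
    exact Curve.repr_zero_eq_eval hK (P i) (hsupp i) (B i) (hB i) (hB1 i) (B₀ a)
  rw [hrow]
  refine ⟨?_, fun hL ↦ ?_⟩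
  · rw [Set.range_comp, Submodule.span_image, B₀.span_eq, Submodule.map_top, Curve.range_evalMap]
  · exact B₀.linearIndependent.map' _ (LinearMap.ker_eq_bot.mpr
      (Curve.evalMap_injective P hP hsupp (by omega)))
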